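/- Let $m,n$ be natural numbers and let $SO(m,n)$ be the group of all real $(m+n)\times(m+n)$ matrices that leave the inner product of signature $(m,n)$ invariant and can be joined to the identity by a continuous path of such matrices. For $P\in\mathbb{R}^{n\times m}$ put $$\beta(P)=\begin{pmatrix}\sqrt{I_m+P^{\mathsf t}P} & P^{\mathsf t}\\ P & \sqrt{I_n+PP^{\mathsf t}}\end{pmatrix},$$ and for $O_m\in SO(m)$, $O_n\in SO(n)$ put $\rho(O_m)=\begin{pmatrix}O_m&0\\0&I_n\end{pmatrix}$ and $\lambda(O_n)=\begin{pmatrix}I_m&0\\0&O_n\end{pmatrix}$; all square roots are positive semidefinite square roots. For $P_1,P_2\in\mathbb{R}^{n\times m}$ put $$P_1\oplus_U P_2=P_1\sqrt{I_m+P_2^{\mathsf t}P_2}+\sqrt{I_n+P_1P_1^{\mathsf t}}\,P_2,$$ $$\mathrm{rgyr}[P_1,P_2]=\left(P_1^{\mathsf t}P_2+\sqrt{I_m+P_1^{\mathsf t}P_1}\sqrt{I_m+P_2^{\mathsf t}P_2}\right)\left(\sqrt{I_m+P_{1,2}^{\mathsf t}P_{1,2}}\right)^{-1},\qquad P_{1,2}=P_1\oplus_U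 P_2,$$ $$P_1\oplus'_U P_2=(P_1\oplus_U P_2)\,\mathrm{rgyr}[P_2,P_1].$$ Let $B$ be a subset and $H_L,H_R$ subgroups of a group $\Gamma$. The decomposition $\Gamma=H_LBH_R$ is a bi-gyrodecomposition if: every $g\in\Gamma$ is uniquely $g=h_\ell b h_r$ with $h_\ell\in H_L$, $b\in B$, $h_r\in H_R$; $hBh^{-1}\subseteq B$ for every $h\in H_L$ and every $h\in H_R$; the elements of $H_L$ commute with those of $H_R$; $1\in B$, $b^{-1}\in B$ and $aba\in B$ for all $a,b\in B$; and, writing $ab=h_\ell(a,b)\,(a\oplus_b b)\,h_r(a,b)$ for the decomposition of the product of $a,b\in B$, one has $h_\ell(a,b)^{-1}=h_\ell(b,a)$ and $h_r(a,b)^{-1}=h_r(b,a)$. The bi-gyrogroup operation on $B$ is then $a\oplus b=h_\ell(b,a)^{-1}(a\oplus_b b)\,h_\ell(b,a)$. A set $G$ with a binary operation $\oplus$ is a gyrogroup if it has an element $0$ with $0\oplus a=a$ for all $a$ and such that every $a$ has some $b$ with $b\oplus a=0$, and if there are automorphisms $\mathrm{gyr}[a,b]$ of $(G,\oplus)$,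 $a,b\in G$, with $a\oplus(b\oplus c)=(a\oplus b)\oplus\mathrm{gyr}[a,b]c$ and $\mathrm{gyr}[a,b]=\mathrm{gyr}[a\oplus b,b]$ for all $a,b,c\in G$; it is gyrocommutative if moreover $a\oplus b=\mathrm{gyr}[a,b](b\oplus a)$ for all $a,b\in G$. Theorem. The decomposition $SO(m,n)=\rho(SO(m))\,\beta(\mathbb{R}^{n\times m})\,\lambda(SO(n))$ is a bi-gyrodecomposition. Its bi-gyrogroup operation $\oplus$ on $\beta(\mathbb{R}^{n\times m})$ is given by $$\beta(P_1)\oplus\beta(P_2)=\beta\big((P_1\oplus_U P_2)\,\mathrm{rgyr}[P_2,P_1]\big),\qquad P_1,P_2\in\mathbb{R}^{n\times m}.$$ With this operation $\beta(\mathbb{R}^{n\times m})$ is a gyrocommutative gyrogroup; $(\mathbb{R}^{n\times m},\oplus'_U)$ is a gyrocommutative gyrogroup as well, and $\beta$ is an isomorphism (a bijection that preserves the operation) from $(\mathbb{R}^{n\times m},\oplus'_U)$ onto $(\beta(\mathbb{R}^{n\times m}),\oplus)$. -/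

import Mathlib

/-! ## Gyrogroups -/

namespace BiGyro

/-- `gyr` is a gyrator turning the groupoid `(G, op)` into a gyrogroup: there is a left identity `e`
with respect to which every element has a left inverse, and every `gyr a b` is an automorphism of
`(G, op)` such that the left gyroassociative law and the left reduction property hold. -/
structure IsGyrogroupWith {G : Type*} (op : G → G → G) (gyr : G → G → G ≃ G) : Prop where
  exists_zero : ∃ e : G, (∀ a, op e a = a) ∧ ∀ a, ∃ b, op b a = e
  gyr_hom : ∀ a b x y, gyr a b (op x y) = op (gyr a b x) (gyr a b y)
  gyr_assoc : ∀ a b c, op a (op b c) = op (op a b) (gyr a b c)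
  gyr_reduction : ∀ a b, gyr a b = gyr (op a b) b

/-- A gyrocommutative gyrogroup: a gyrogroup with `a ⊕ b = gyr[a, b](b ⊕ a)`. -/
def IsGyrocommutativeGyrogroup {G : Type*} (op : G → G → G) : Prop :=
  ∃ gyr : G → G → G ≃ G, IsGyrogroupWith op gyr ∧ ∀ a b, op a b = gyr a b (op b a)

/-- An isomorphism of groupoids (equivalently, of gyrogroups): a bijection that preserves the
operation. -/
def IsGroupoidIso {G H : Type*} (op₁ : G → G → G) (op₂ : H → H → H) (f : G → H) : Prop :=
  Function.Bijective f ∧ ∀ a b, f (op₁ a b) = op₂ (f a) (f b)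

/-! ## Bi-gyrodecompositions of groups and bi-gyrogroups

The group `Γ` that is decomposed is given as a subgroup of an ambient group `G`. -/

section Decomposition

variable {G : Type*} [Group G]

/-- `B` is a bi-transversal of the subgroups `HL` and `HR` of the group `Γ`: every `g ∈ Γ` is
uniquely of the form `g = hl * b * hr` with `hl ∈ HL`, `b ∈ B`, `hr ∈ HR`. -/
structure IsBiTransversal (Γ HL : Subgroup G) (B : Set G) (HR : Subgroup G) : Prop where
  left_le : HL ≤ Γ
  subset : B ⊆ Γ
  right_le : HR ≤ Γ
  existsUnique : ∀ g ∈ Γ, ∃! t : HL × B × HR, g = (t.1 : G) * (t.2.1 : G) * (t.2.2 : G)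

namespace IsBiTransversal

variable {Γ HL : Subgroup G} {B : Set G} {HR : Subgroup G}

/-- The unique decomposition of the product `b₁ b₂`. -/
noncomputable def decomp (h : IsBiTransversal Γ HL B HR) (b₁ b₂ : B) : HL × B × HR :=
  (h.existsUnique (b₁ * b₂ : G) (Γ.mul_mem (h.subset b₁.2) (h.subset b₂.2))).choose

/-- The left transversal map `h_ℓ`. -/
noncomputable def leftMap (h : IsBiTransversal Γ HL B HR) (b₁ b₂ : B) : HL :=
  (h.decomp b₁ b₂).1

/-- The bi-transversal operation. -/
noncomputable def biOp (h : IsBiTransversal Γ HL B HR) (b₁ b₂ : B) : B :=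
  (h.decomp b₁ b₂).2.1

/-- The right transversal map `h_r`. -/
noncomputable def rightMap (h : IsBiTransversal Γ HL B HR) (b₁ b₂ : B) : HR :=
  (h.decomp b₁ b₂).2.2

theorem mul_eq (h : IsBiTransversal Γ HL B HR) (b₁ b₂ : B) :
    (b₁ * b₂ : G) = (h.leftMap b₁ b₂ : G) * (h.biOp b₁ b₂ : G) * (h.rightMap b₁ b₂ : G) :=
  (h.existsUnique (b₁ * b₂ : G) (Γ.mul_mem (h.subset b₁.2) (h.subset b₂.2))).choose_spec.1

end IsBiTransversal

/-- A bi-gyrotransversal: a bi-transversal that is normalized by `HL` and `HR`, where `HL` and `HR`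
commute elementwise. -/
structure IsBiGyrotransversal (Γ HL : Subgroup G) (B : Set G) (HR : Subgroup G) : Prop
    extends IsBiTransversal Γ HL B HR where
  left_normalizes : ∀ h ∈ HL, ∀ b ∈ B, h * b * h⁻¹ ∈ B
  right_normalizes : ∀ h ∈ HR, ∀ b ∈ B, h * b * h⁻¹ ∈ B
  comm : ∀ hl ∈ HL, ∀ hr ∈ HR, hl * hr = hr * hl

/-- The right gyration `rgyr[b₁, b₂] b = h_ℓ(b₁, b₂)⁻¹ b h_ℓ(b₁, b₂)` of `B`. -/
noncomputable def IsBiGyrotransversal.rgyr {Γ HL : Subgroup G} {B : Set G} {HR : Subgroup G}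
    (h : IsBiGyrotransversal Γ HL B HR) (b₁ b₂ b : B) : B :=
  ⟨(h.leftMap b₁ b₂ : G)⁻¹ * b * (h.leftMap b₁ b₂ : G), by
    simpa using h.left_normalizes _ (HL.inv_mem (h.leftMap b₁ b₂).2) b b.2⟩

/-- Twisted subgroups of a group. -/
structure IsTwistedSubgroup (B : Set G) : Prop where
  one_mem : (1 : G) ∈ B
  inv_mem : ∀ b ∈ B, b⁻¹ ∈ B
  mul_mul_mem : ∀ a ∈ B, ∀ b ∈ B, a * b * a ∈ B

/-- `Γ = HL B HR` is a bi-gyrodecomposition. -/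
structure IsBiGyrodecomposition (Γ HL : Subgroup G) (B : Set G) (HR : Subgroup G) : Prop
    extends IsBiGyrotransversal Γ HL B HR where
  twisted : IsTwistedSubgroup B
  leftMap_inv : ∀ a b : B,
    (toIsBiGyrotransversal.leftMap a b)⁻¹ = toIsBiGyrotransversal.leftMap b a
  rightMap_inv : ∀ a b : B,
    (toIsBiGyrotransversal.rightMap a b)⁻¹ = toIsBiGyrotransversal.rightMap b a

/-- The bi-gyrogroup operation `a ⊕ b = rgyr[b, a](a ⊕_b b)` of a bi-gyrodecomposition, where `⊕_b`
is the bi-transversal operation. -/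
noncomputable def IsBiGyrodecomposition.op {Γ HL : Subgroup G} {B : Set G} {HR : Subgroup G}
    (h : IsBiGyrodecomposition Γ HL B HR) (a b : B) : B :=
  h.rgyr b a (h.biOp a b)

end Decomposition

/-! ## The special pseudo-orthogonal group and its bi-decomposition -/

section PseudoOrthogonal

open Matrix
open scoped MatrixOrder

/-- The pseudo-orthogonal group `O(m, n)`: the invertible matrices that leave the inner product of
signature `(m, n)` invariant. -/
def pseudoOrthogonalGroup (m n : ℕ) : Subgroup (GL (Fin m ⊕ Fin n) ℝ) where
  carrier := {A | (A : Matrix (Fin m ⊕ Fin n) (Fin m ⊕ Fin n) ℝ)ᵀ *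
    LieAlgebra.Orthogonal.indefiniteDiagonal (Fin m) (Fin n) ℝ * (A : Matrix (Fin m ⊕ Fin n) (Fin m ⊕ Fin n) ℝ) =
    LieAlgebra.Orthogonal.indefiniteDiagonal (Fin m) (Fin n) ℝ}
  one_mem' := by simp
  mul_mem' := by
    intro A B hA hB
    simp only [Set.mem_ofPred_eq] at hA hB ⊢
    calc _ = (B : Matrix (Fin m ⊕ Fin n) (Fin m ⊕ Fin n) ℝ)ᵀ *
          ((A : Matrix (Fin m ⊕ Fin n) (Fin m ⊕ Fin n) ℝ)ᵀ *
            LieAlgebra.Orthogonal.indefiniteDiagonal (Fin m) (Fin n) ℝ *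
            (A : Matrix (Fin m ⊕ Fin n) (Fin m ⊕ Fin n) ℝ)) *
          (B : Matrix (Fin m ⊕ Fin n) (Fin m ⊕ Fin n) ℝ) := by
            simp only [Units.val_mul, transpose_mul, Matrix.mul_assoc]
      _ = _ := by rw [hA, hB]
  inv_mem' := by
    intro A hA
    simp only [Set.mem_ofPred_eq] at hA ⊢
    have h1 : (A : Matrix (Fin m ⊕ Fin n) (Fin m ⊕ Fin n) ℝ) * (A⁻¹).val = 1 := A.mul_inv
    have h2 : (A⁻¹).valᵀ * (A : Matrix (Fin m ⊕ Fin n) (Fin m ⊕ Fin n) ℝ)ᵀ = 1 := by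
      rw [← transpose_mul, h1, transpose_one]
    calc _ = (A⁻¹).valᵀ * ((A : Matrix (Fin m ⊕ Fin n) (Fin m ⊕ Fin n) ℝ)ᵀ *
            LieAlgebra.Orthogonal.indefiniteDiagonal (Fin m) (Fin n) ℝ *
            (A : Matrix (Fin m ⊕ Fin n) (Fin m ⊕ Fin n) ℝ)) * (A⁻¹).val := by rw [hA]
      _ = ((A⁻¹).valᵀ * (A : Matrix (Fin m ⊕ Fin n) (Fin m ⊕ Fin n) ℝ)ᵀ) *
            LieAlgebra.Orthogonal.indefiniteDiagonal (Fin m) (Fin n) ℝ *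
            ((A : Matrix (Fin m ⊕ Fin n) (Fin m ⊕ Fin n) ℝ) * (A⁻¹).val) := by
            simp only [Matrix.mul_assoc]
      _ = _ := by rw [h1, h2, Matrix.one_mul, Matrix.mul_one]

/-- The special pseudo-orthogonal group `SO(m, n)`: the elements of `O(m, n)` that can be reached
from the identity by a continuous path in `O(m, n)`. -/
def specialPseudoOrthogonalGroup (m n : ℕ) : Subgroup (GL (Fin m ⊕ Fin n) ℝ) :=
  (Subgroup.pathComponentOne (pseudoOrthogonalGroup m n)).map (pseudoOrthogonalGroup m n).subtype

/-- The homomorphism `ρ : O ↦ diag(O, I_n)` of `SO(m)`. -/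
noncomputable def rho (m n : ℕ) :
    specialOrthogonalGroup (Fin m) ℝ →* GL (Fin m ⊕ Fin n) ℝ :=
  MonoidHom.toHomUnits
    { toFun := fun O => fromBlocks (O : Matrix (Fin m) (Fin m) ℝ) 0 0 1
      map_one' := by simp
      map_mul' := by intro A B; simp [fromBlocks_multiply] }

/-- The homomorphism `λ : O ↦ diag(I_m, O)` of `SO(n)`. -/
noncomputable def lam (m n : ℕ) :
    specialOrthogonalGroup (Fin n) ℝ →* GL (Fin m ⊕ Fin n) ℝ :=
  MonoidHom.toHomUnits
    { toFun := fun O => fromBlocks 1 0 0 (O : Matrix (Fin n) (Fin n) ℝ)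
      map_one' := by simp
      map_mul' := by intro A B; simp [fromBlocks_multiply] }

variable {m n : ℕ}

/-- `√(I_m + Pᵀ P)`, the positive semidefinite square root. -/
noncomputable def sqrtL (P : Matrix (Fin n) (Fin m) ℝ) : Matrix (Fin m) (Fin m) ℝ :=
  CFC.sqrt (1 + Pᵀ * P)

/-- `√(I_n + P Pᵀ)`, the positive semidefinite square root. -/
noncomputable def sqrtR (P : Matrix (Fin n) (Fin m) ℝ) : Matrix (Fin n) (Fin n) ℝ :=
  CFC.sqrt (1 + P * Pᵀ)

/-- The matrix `β(P)`. -/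
noncomputable def betaMatrix (P : Matrix (Fin n) (Fin m) ℝ) :
    Matrix (Fin m ⊕ Fin n) (Fin m ⊕ Fin n) ℝ :=
  fromBlocks (sqrtL P) Pᵀ P (sqrtR P)

theorem posSemidef_L (P : Matrix (Fin n) (Fin m) ℝ) : (1 + Pᵀ * P).PosSemidef := by
  simpa using PosSemidef.one.add (posSemidef_conjTranspose_mul_self P)

theorem posSemidef_R (P : Matrix (Fin n) (Fin m) ℝ) : (1 + P * Pᵀ).PosSemidef := by
  simpa using PosSemidef.one.add (posSemidef_self_mul_conjTranspose P)

theorem sqrtL_mul_self (P : Matrix (Fin n) (Fin m) ℝ) : sqrtL P * sqrtL P = 1 + Pᵀ * P :=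
  CFC.sqrt_mul_sqrt_self _ (posSemidef_L P).nonneg

theorem sqrtR_mul_self (P : Matrix (Fin n) (Fin m) ℝ) : sqrtR P * sqrtR P = 1 + P * Pᵀ :=
  CFC.sqrt_mul_sqrt_self _ (posSemidef_R P).nonneg

@[simp] theorem sqrtL_neg (P : Matrix (Fin n) (Fin m) ℝ) : sqrtL (-P) = sqrtL P := by
  simp [sqrtL]

@[simp] theorem sqrtR_neg (P : Matrix (Fin n) (Fin m) ℝ) : sqrtR (-P) = sqrtR P := by
  simp [sqrtR]

theorem sqrt_blocks (P : Matrix (Fin n) (Fin m) ℝ) :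
    CFC.sqrt (fromBlocks (1 + Pᵀ * P) 0 0 (1 + P * Pᵀ)) =
      fromBlocks (sqrtL P) 0 0 (sqrtR P) := by
  have hL : (sqrtL P).PosSemidef := (CFC.sqrt_nonneg (1 + Pᵀ * P)).posSemidef
  have hR : (sqrtR P).PosSemidef := (CFC.sqrt_nonneg (1 + P * Pᵀ)).posSemidef
  refine CFC.sqrt_unique ?_ (PosSemidef.nonneg ?_)
  · simp [fromBlocks_multiply, sqrtL_mul_self, sqrtR_mul_self]
  · refine PosSemidef.of_dotProduct_mulVec_nonneg ?_ fun x => ?_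
    · exact hL.1.fromBlocks (by simp) hR.1
    · have h1 := hL.dotProduct_mulVec_nonneg (x ∘ Sum.inl)
      have h2 := hR.dotProduct_mulVec_nonneg (x ∘ Sum.inr)
      simp only [fromBlocks_mulVec, dotProduct, Fintype.sum_sum_type, Pi.star_apply,
        Sum.elim_inl, Sum.elim_inr, zero_mulVec, add_zero, zero_add,
        Function.comp_apply] at h1 h2 ⊢
      exact add_nonneg h1 h2

theorem blocks_commute (P : Matrix (Fin n) (Fin m) ℝ) :
    Commute (fromBlocks (sqrtL P) 0 0 (sqrtR P)) (fromBlocks 0 Pᵀ P 0) := by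
  rw [← sqrt_blocks, CFC.sqrt_eq_cfc]
  refine Commute.cfc_nnreal ?_ _
  simp [Commute, SemiconjBy, fromBlocks_multiply, Matrix.add_mul, Matrix.mul_add,
    Matrix.mul_assoc]

theorem mul_sqrtL (P : Matrix (Fin n) (Fin m) ℝ) : P * sqrtL P = sqrtR P * P := by
  have h := (blocks_commute P).eq
  simp only [fromBlocks_multiply, fromBlocks_inj] at h
  simpa using h.2.2.1.symm

theorem sqrtL_mul_transpose (P : Matrix (Fin n) (Fin m) ℝ) :
    sqrtL P * Pᵀ = Pᵀ * sqrtR P := by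
  have h := (blocks_commute P).eq
  simp only [fromBlocks_multiply, fromBlocks_inj] at h
  simpa using h.2.1

theorem betaMatrix_mul_neg (P : Matrix (Fin n) (Fin m) ℝ) :
    betaMatrix P * betaMatrix (-P) = 1 := by
  simp [betaMatrix, fromBlocks_multiply, sqrtL_mul_self, sqrtR_mul_self, mul_sqrtL,
    sqrtL_mul_transpose, ← fromBlocks_one]

/-- The map `β` into the invertible matrices. -/
noncomputable def beta (P : Matrix (Fin n) (Fin m) ℝ) : GL (Fin m ⊕ Fin n) ℝ where
  val := betaMatrix P
  inv := betaMatrix (-P)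
  val_inv := betaMatrix_mul_neg P
  inv_val := by simpa using betaMatrix_mul_neg (-P)

/-- The bi-gyroaddition `P₁ ⊕_U P₂ = P₁ √(I_m + P₂ᵀ P₂) + √(I_n + P₁ P₁ᵀ) P₂`. -/
noncomputable def addU (P₁ P₂ : Matrix (Fin n) (Fin m) ℝ) : Matrix (Fin n) (Fin m) ℝ :=
  P₁ * sqrtL P₂ + sqrtR P₁ * P₂

/-- The right gyration matrix `rgyr[P₁, P₂]`, an `m × m` matrix. -/
noncomputable def rgyrU (P₁ P₂ : Matrix (Fin n) (Fin m) ℝ) : Matrix (Fin m) (Fin m) ℝ :=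
  (P₁ᵀ * P₂ + sqrtL P₁ * sqrtL P₂) * (sqrtL (addU P₁ P₂))⁻¹

/-- The operation `P₁ ⊕'_U P₂ = (P₁ ⊕_U P₂) rgyr[P₂, P₁]`. -/
noncomputable def addU' (P₁ P₂ : Matrix (Fin n) (Fin m) ℝ) : Matrix (Fin n) (Fin m) ℝ :=
  addU P₁ P₂ * rgyrU P₂ P₁

end PseudoOrthogonal

end BiGyro

open BiGyro

/-! The theorem is a form of the polar decomposition. Let `σ` be conjugation by `η = diag(I_m,
-I_n)`. It fixes the block-diagonal subgroups `HL = ρ(SO(m))` and `HR = λ(SO(n))` pointwise and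
inverts every element of `B = β(ℝ^{n×m})`, and `B` consists exactly of the positive semidefinite
pseudo-orthogonal matrices. This description makes it clear that `B` is stable under `b ↦ aba` and
under conjugation by `HL` and `HR`.

The algebra uses only `σ`. Put `K = HL HR`. If `ab = cκ` with `a, b, c ∈ B` and `κ ∈ K`, then
applying `σ` and inverting gives `ba = κ⁻¹c`. With `a ⊕ b = c` and `gyr[a,b]` the conjugation by
`κ`, gyrocommutativity follows from this identity, gyroassociativity from associativity in the
group, and the reduction law from `cb = κ(bab)`, since `bab ∈ B`. The bi-gyrogroup operation is this
`B`-component: conjugating the middle factor of `h_ℓ c h_r` by `h_ℓ` moves `h_ℓ` to the right.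

The analytic part is that `SO(m, n)`, defined by paths, equals `HL B HR`. Rotations are joined to
the identity by pairing reflections, and elements of `B` by a Cayley path. Conversely, `AᵀA = I +
CᵀC` keeps the determinants of the diagonal blocks away from zero on `O(m, n)`, so they stay
positive along a path from the identity, and the orthogonal factors have determinant `1`. The
explicit left factor is the matrix `rgyr`, which yields the formula for the operation. -/

namespace BiGyro

/-! ### Gyrogroups from decompositions with an involution -/

section Abstract

variable {G : Type*} [Group G]

/-- If `B` is a twisted subgroup that is normalized by a subgroup `K`, the decompositions `b * k`
are unique and some endomorphism inverts the elements of `B` and fixes those of `K`, then taking the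
`B`-component of the product makes `B` a gyrocommutative gyrogroup. -/
theorem isGyrocommutativeGyrogroup_of_polar {K : Subgroup G} {B : Set G}
    (hB : IsTwistedSubgroup B) (hK : ∀ k ∈ K, ∀ b ∈ B, k * b * k⁻¹ ∈ B)
    (huniq : ∀ b ∈ B, ∀ c ∈ B, ∀ k ∈ K, ∀ l ∈ K, b * k = c * l → b = c)
    (σ : G →* G) (σB : ∀ b ∈ B, σ b = b⁻¹) (σK : ∀ k ∈ K, σ k = k)
    (op : B → B → B) (κ : B → B → K)
    (hop : ∀ a b : B, (a * b : G) = op a b * κ a b) :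
    IsGyrocommutativeGyrogroup op := by
  have huniq' : ∀ b c : B, ∀ k l : K, (b * k : G) = c * l → b = c ∧ k = l := by
    intro b c k l h
    have e := huniq b b.2 c c.2 k k.2 l l.2 h
    rw [e] at h
    exact ⟨Subtype.ext e, Subtype.ext (mul_left_cancel h)⟩
  let cj (k : K) : B ≃ B :=
    { toFun := fun b => ⟨k * b * (k : G)⁻¹, hK k k.2 b b.2⟩
      invFun := fun b => ⟨(k : G)⁻¹ * b * k, by simpa using hK _ (K.inv_mem k.2) b b.2⟩
      left_inv := fun b => by ext; simp [mul_assoc]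
      right_inv := fun b => by ext; simp [mul_assoc] }
  have cj_apply (k : K) (b : B) : (cj k b : G) = k * b * (k : G)⁻¹ := rfl
  have op_eq {a b c : B} {k : K} (h : (a * b : G) = c * k) : op a b = c ∧ κ a b = k :=
    huniq' _ _ _ _ ((hop a b).symm.trans h)
  -- Applying `σ` to `ab = (a ⊕ b)κ` gives `a⁻¹b⁻¹ = (a ⊕ b)⁻¹κ`; now invert.
  have swap (a b : B) : (b * a : G) = (κ a b : G)⁻¹ * op a b := by
    have h := congrArg σ (hop a b)
    rw [map_mul, map_mul, σB _ a.2, σB _ b.2, σB _ (op a b).2, σK _ (κ a b).2] at h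
    have h' := congrArg (·⁻¹) h
    simpa using h'
  refine ⟨fun a b => cj (κ a b), ⟨⟨⟨1, hB.one_mem⟩, fun a => ?_, fun a => ?_⟩, ?_, ?_, ?_⟩, ?_⟩
  · exact (op_eq (k := 1) (by simp)).1
  · exact ⟨⟨(a : G)⁻¹, hB.inv_mem a a.2⟩, (op_eq (k := 1) (by simp)).1⟩
  · intro a b x y
    refine (op_eq (k := κ a b * κ x y * (κ a b)⁻¹) ?_).1.symm
    simp only [cj_apply, Subgroup.coe_mul, Subgroup.coe_inv]
    calc _ = (κ a b : G) * (x * y) * (κ a b : G)⁻¹ := by group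
      _ = _ := by rw [hop]; group
  · intro a b c
    -- Both sides are `B`-components of `abc`, bracketed in the two ways; `κ a b` is moved past `c`
    -- by conjugation.
    refine (huniq' _ _ (κ a (op b c) * κ b c) (κ (op a b) (cj (κ a b) c) * κ a b) ?_).1
    simp only [Subgroup.coe_mul]
    rw [← mul_assoc, ← hop, ← mul_assoc, ← hop, cj_apply, mul_assoc, ← hop, ← mul_assoc, hop a b]
    group
  · intro a b
    congr 1
    -- By `swap`, `a ⊕ b = κba`, so `(a ⊕ b)b = κ(bab)κ⁻¹ · κ`, whose `K`-component is again `κ`.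
    refine (op_eq (c := cj (κ a b) ⟨b * a * b, hB.mul_mul_mem b b.2 a a.2⟩) ?_).2.symm
    simp only [cj_apply]
    rw [swap a b]
    group
  · intro a b
    ext
    have h : op b a = (κ a b : G)⁻¹ * op a b * κ a b := by
      have e := op_eq (a := b) (b := a) (c := (cj (κ a b)).symm (op a b)) (k := (κ a b)⁻¹) (by
        rw [swap a b]
        change _ = (κ a b : G)⁻¹ * op a b * κ a b * ((κ a b)⁻¹ : K)
        simp)
      rw [e.1]; rfl
    rw [cj_apply, h]
    group

variable {Γ HL HR : Subgroup G} {B : Set G}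

theorem IsBiTransversal.eq_of_mul_eq_mul (h : IsBiTransversal Γ HL B HR) {x y : HL} {b c : B}
    {u v : HR} (e : (x * b * u : G) = y * c * v) : x = y ∧ b = c ∧ u = v := by
  have hm : (x * b * u : G) ∈ Γ :=
    Γ.mul_mem (Γ.mul_mem (h.left_le x.2) (h.subset b.2)) (h.right_le u.2)
  have := (h.existsUnique _ hm).unique (y₁ := (x, b, u)) (y₂ := (y, c, v)) rfl e
  simpa using this

theorem IsBiTransversal.maps_eq (h : IsBiTransversal Γ HL B HR) {a b c : B} {x : HL} {u : HR}
    (e : (a * b : G) = x * c * u) :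
    h.leftMap a b = x ∧ h.biOp a b = c ∧ h.rightMap a b = u :=
  h.eq_of_mul_eq_mul ((h.mul_eq a b).symm.trans e)

/-- From `ab = xcu`, applying `σ` and inverting gives `ba = u⁻¹cx⁻¹`. As `x` and `u` commute and
normalize `B`, this equals `x⁻¹ (x u⁻¹ c u x⁻¹) u⁻¹`, a decomposition of the required shape. -/
theorem IsBiGyrotransversal.mul_swap_eq (h : IsBiGyrotransversal Γ HL B HR)
    (σ : G →* G) (σB : ∀ b ∈ B, σ b = b⁻¹) (σL : ∀ k ∈ HL, σ k = k) (σR : ∀ k ∈ HR, σ k = k)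
    (a b : B) :
    (h.leftMap a b)⁻¹ = h.leftMap b a ∧ (h.rightMap a b)⁻¹ = h.rightMap b a := by
  set x := h.leftMap a b with hx
  set u := h.rightMap a b with hu
  have e := congrArg σ (h.mul_eq a b)
  simp only [map_mul] at e
  rw [σB _ a.2, σB _ b.2, σB _ (h.biOp a b).2, σL _ (h.leftMap a b).2, σR _ (h.rightMap a b).2,
    ← hx, ← hu] at e
  have e' : (b * a : G) = (u : G)⁻¹ * h.biOp a b * (x : G)⁻¹ := by
    have := congrArg (·⁻¹) e
    simpa [mul_assoc] using this
  have m1 := h.right_normalizes _ (HR.inv_mem u.2) _ (h.biOp a b).2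
  have m2 := h.left_normalizes _ x.2 _ m1
  have key := h.maps_eq (a := b) (b := a) (x := x⁻¹) (u := u⁻¹) (c := ⟨_, m2⟩) (by
    rw [e']
    have hc : (x : G)⁻¹ * (u : G)⁻¹ = (u : G)⁻¹ * (x : G)⁻¹ :=
      h.comm _ (HL.inv_mem x.2) _ (HR.inv_mem u.2)
    simp only [Subgroup.coe_inv, inv_inv]
    calc _ = (u : G)⁻¹ * h.biOp a b * u * ((u : G)⁻¹ * (x : G)⁻¹) := by group
      _ = _ := by rw [← hc]; group)
  exact ⟨key.1.symm, key.2.2.symm⟩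

theorem IsBiGyrotransversal.isBiGyrodecomposition (h : IsBiGyrotransversal Γ HL B HR)
    (hB : IsTwistedSubgroup B)
    (σ : G →* G) (σB : ∀ b ∈ B, σ b = b⁻¹) (σL : ∀ k ∈ HL, σ k = k) (σR : ∀ k ∈ HR, σ k = k) :
    IsBiGyrodecomposition Γ HL B HR where
  toIsBiGyrotransversal := h
  twisted := hB
  leftMap_inv a b := (h.mul_swap_eq σ σB σL σR a b).1
  rightMap_inv a b := (h.mul_swap_eq σ σB σL σR a b).2

/-- Since `h_ℓ(b, a)⁻¹ = h_ℓ(a, b)`, the operation conjugates the middle factor by `h_ℓ(a, b)`. It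
is therefore the `B`-component with respect to `HL HR` placed on the right. -/
theorem IsBiGyrodecomposition.mul_eq_op_mul (h : IsBiGyrodecomposition Γ HL B HR) (a b : B) :
    (a * b : G) = h.op a b * (h.leftMap a b * h.rightMap a b) := by
  rw [h.mul_eq a b]
  change _ = ((h.leftMap b a : G)⁻¹ * h.biOp a b * h.leftMap b a) * _
  rw [← h.leftMap_inv a b, Subgroup.coe_inv]
  group

theorem IsBiGyrodecomposition.isGyrocommutativeGyrogroup_op
    (h : IsBiGyrodecomposition Γ HL B HR)
    (σ : G →* G) (σB : ∀ b ∈ B, σ b = b⁻¹) (σL : ∀ k ∈ HL, σ k = k) (σR : ∀ k ∈ HR, σ k = k) :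
    IsGyrocommutativeGyrogroup h.op := by
  let φ : HL × HR →* G :=
    MonoidHom.noncommCoprod HL.subtype HR.subtype fun x u => h.comm x x.2 u u.2
  have hφ (p : HL × HR) : φ p = p.1 * p.2 := rfl
  refine isGyrocommutativeGyrogroup_of_polar (K := φ.range) h.twisted ?_ ?_ σ σB ?_ h.op
    (fun a b => ⟨_, ⟨(h.leftMap a b, h.rightMap a b), rfl⟩⟩) h.mul_eq_op_mul
  · rintro _ ⟨⟨x, u⟩, rfl⟩ b hb
    simpa [hφ, mul_assoc] using
      h.left_normalizes _ x.2 _ (h.right_normalizes _ u.2 b hb)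
  · rintro b hb c hc _ ⟨⟨x, u⟩, rfl⟩ _ ⟨⟨y, v⟩, rfl⟩ e
    simp only [hφ] at e
    -- Writing `bxu = x(x⁻¹bx)u` turns a factorization in `B · HL HR` into one in `HL · B · HR`,
    -- where uniqueness is known.
    have m1 := h.left_normalizes _ (HL.inv_mem x.2) b hb
    have m2 := h.left_normalizes _ (HL.inv_mem y.2) c hc
    obtain ⟨rfl, -, rfl⟩ := h.eq_of_mul_eq_mul (x := x) (y := y) (b := ⟨_, m1⟩) (c := ⟨_, m2⟩)
      (u := u) (v := v) (by simpa [mul_assoc] using e)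
    exact mul_right_cancel e
  · rintro _ ⟨⟨x, u⟩, rfl⟩
    rw [hφ, map_mul, σL _ x.2, σR _ u.2]

end Abstract

/-- Gyrocommutative gyrogroups can be pulled back along isomorphisms of groupoids. -/
theorem IsGroupoidIso.isGyrocommutativeGyrogroup {G H : Type*} {op₁ : G → G → G}
    {op₂ : H → H → H} {f : G → H} (hf : IsGroupoidIso op₁ op₂ f)
    (h : IsGyrocommutativeGyrogroup op₂) : IsGyrocommutativeGyrogroup op₁ := by
  obtain ⟨gyr, ⟨⟨e, he, hinv⟩, hhom, hassoc, hred⟩, hcomm⟩ := h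
  obtain ⟨hbij, hop⟩ := hf
  let F := Equiv.ofBijective f hbij
  have hF (a : H) : f (F.symm a) = a := F.apply_symm_apply a
  have hFop (a b : H) : F.symm (op₂ a b) = op₁ (F.symm a) (F.symm b) :=
    hbij.1 (by rw [hF, hop, hF, hF])
  let g (a b : G) : G ≃ G := F.trans ((gyr (f a) (f b)).trans F.symm)
  have hg (a b c : G) : f (g a b c) = gyr (f a) (f b) (f c) := hF _
  refine ⟨g, ⟨⟨F.symm e, fun a => hbij.1 ?_, fun a => ?_⟩, fun a b x y => hbij.1 ?_,
    fun a b c => hbij.1 ?_, fun a b => Equiv.ext fun c => hbij.1 ?_⟩, fun a b => hbij.1 ?_⟩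
  · rw [hop, hF, he]
  · obtain ⟨b, hb⟩ := hinv (f a)
    exact ⟨F.symm b, hbij.1 (by rw [hop, hF, hF, hb])⟩
  · simp only [hop, hg, hhom]
  · simp only [hop, hg, hassoc]
  · rw [hg, hg, hop, ← hred]
  · rw [hg, hop, hop, ← hcomm]

/-! ### Path-connectedness of the rotation group -/

section SpecialOrthogonal

open Matrix

variable {ι : Type*} [Fintype ι] [DecidableEq ι]

/-- The matrix of the reflection in the hyperplane orthogonal to `v`; it is `1` if `v = 0`. -/
noncomputable def householder (v : ι → ℝ) : Matrix ι ι ℝ :=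
  1 - (2 / (v ⬝ᵥ v)) • vecMulVec v v

@[simp] theorem householder_zero : householder (0 : ι → ℝ) = 1 := by simp [householder]

@[simp] theorem householder_neg (v : ι → ℝ) : householder (-v) = householder v := by
  simp [householder, vecMulVec_neg, neg_vecMulVec]

theorem transpose_householder (v : ι → ℝ) : (householder v)ᵀ = householder v := by
  simp [householder, transpose_vecMulVec]

theorem householder_mul_self (v : ι → ℝ) : householder v * householder v = 1 := by
  rcases eq_or_ne v 0 with rfl | hv
  · simp
  have h : v ⬝ᵥ v ≠ 0 := by simpa using hv
  simp only [householder, sub_mul, mul_sub, one_mul, mul_one, smul_mul_smul_comm,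
    vecMulVec_mul_vecMulVec, vecMulVec_smul, smul_smul, ← sub_smul, sub_sub, ← add_smul]
  rw [sub_eq_self]
  convert zero_smul ℝ (vecMulVec v v) using 2
  field_simp
  ring

theorem det_householder {v : ι → ℝ} (hv : v ≠ 0) : (householder v).det = -1 := by
  have h : v ⬝ᵥ v ≠ 0 := by simpa using hv
  have e : householder v =
      1 + replicateCol Unit (-(2 / (v ⬝ᵥ v)) • v) * replicateRow Unit v := by
    rw [householder, sub_eq_add_neg, vecMulVec_eq Unit]
    ext; simp [mul_apply, mul_assoc]
  rw [e, det_one_add_replicateCol_mul_replicateRow]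
  simp only [dotProduct_smul, smul_eq_mul]
  field_simp
  norm_num

theorem householder_mulVec (v x : ι → ℝ) :
    householder v *ᵥ x = x - (2 * (v ⬝ᵥ x) / (v ⬝ᵥ v)) • v := by
  simp only [householder, sub_mulVec, one_mulVec, smul_mulVec, vecMulVec_mulVec]
  rw [op_smul_eq_smul, smul_smul]
  congr 2
  ring

theorem toEuclideanCLM_householder (v x : EuclideanSpace ℝ ι) :
    toEuclideanCLM (𝕜 := ℝ) (householder v.ofLp) x =
      (Submodule.span ℝ {v})ᗮ.reflection x := by
  rw [Submodule.reflection_orthogonal_apply, Submodule.reflection_singleton_apply]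
  apply (WithLp.linearEquiv 2 ℝ (ι → ℝ)).injective
  have h1 : inner ℝ v x = v.ofLp ⬝ᵥ x.ofLp := by
    rw [EuclideanSpace.inner_eq_star_dotProduct, star_trivial, dotProduct_comm]
  have h2 : ‖v‖ ^ 2 = v.ofLp ⬝ᵥ v.ofLp := by
    rw [EuclideanSpace.real_norm_sq_eq]; simp [dotProduct, sq]
  simp only [WithLp.linearEquiv_apply, AddEquiv.toEquiv_eq_coe, Equiv.toFun_as_coe,
    EquivLike.coe_coe, WithLp.addEquiv_apply, ofLp_toEuclideanCLM, householder_mulVec,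
    WithLp.ofLp_neg, WithLp.ofLp_sub, WithLp.ofLp_smul, RCLike.ofReal_real_eq_id, id, h1, h2]
  rw [neg_sub, two_smul, ← add_smul]
  congr 2
  ring

/-- **Cartan–Dieudonné** for orthogonal matrices. -/
theorem exists_eq_prod_householder {A : Matrix ι ι ℝ} (hA : Aᵀ * A = 1) :
    ∃ l : List (ι → ℝ), A = (l.map householder).prod := by
  have hA' : A * Aᵀ = 1 := mul_eq_one_comm.mp hA
  have hU : toEuclideanCLM (𝕜 := ℝ) A ∈ unitary (EuclideanSpace ℝ ι →L[ℝ] EuclideanSpace ℝ ι) := by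
    rw [Unitary.mem_iff, ← map_star, ← map_mul, ← map_mul, star_eq_conjTranspose,
      conjTranspose_eq_transpose_of_trivial, hA, hA', map_one]
    exact ⟨rfl, rfl⟩
  obtain ⟨l, -, hl⟩ :=
    LinearIsometryEquiv.reflections_generate_dim (Unitary.linearIsometryEquiv ⟨_, hU⟩)
  refine ⟨l.map (·.ofLp), (toEuclideanCLM (n := ι) (𝕜 := ℝ)).injective ?_⟩
  ext1 x
  change toEuclideanCLM (𝕜 := ℝ) A x = toEuclideanCLM (𝕜 := ℝ) _ x
  have h1 : toEuclideanCLM (𝕜 := ℝ) A x = Unitary.linearIsometryEquiv ⟨_, hU⟩ x := rfl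
  rw [h1, hl]
  clear hl h1
  induction l generalizing x with
  | nil => simp
  | cons v l ih =>
    simp only [List.map_cons, List.prod_cons]
    rw [map_mul]
    change (Submodule.span ℝ {v})ᗮ.reflection
        ((l.map fun v => (Submodule.span ℝ {v})ᗮ.reflection).prod x) =
      toEuclideanCLM (𝕜 := ℝ) (householder v.ofLp) (toEuclideanCLM (𝕜 := ℝ) _ x)
    rw [ih, toEuclideanCLM_householder]

theorem joinedIn_mul {A B : Matrix ι ι ℝ} (hA : JoinedIn {A | Aᵀ * A = 1} 1 A)
    (hB : JoinedIn {A | Aᵀ * A = 1} 1 B) : JoinedIn {A | Aᵀ * A = 1} 1 (A * B) := by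
  have := hA.mul hB
  rw [mul_one] at this
  refine this.mono ?_
  rintro _ ⟨C, hC, D, hD, rfl⟩
  simp only [Set.mem_ofPred_eq] at hC hD ⊢
  rw [transpose_mul, Matrix.mul_assoc, ← Matrix.mul_assoc Cᵀ, hC, Matrix.one_mul, hD]

/-- Move the second mirror onto the first: along the segment `w` from `u` to `v`, the product `H_u
H_w` starts at `H_u H_u = 1`. Replacing `v` by `-v` does not change its reflection, so `u ⬝ᵥ v ≥ 0`
may be assumed, and then the segment avoids zero. -/
theorem joinedIn_householder_mul_householder {u v : ι → ℝ} (hu : u ≠ 0) (hv : v ≠ 0) :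
    JoinedIn {A | Aᵀ * A = 1} 1 (householder u * householder v) := by
  wlog huv : 0 ≤ u ⬝ᵥ v generalizing v
  · rw [← householder_neg v]
    exact this (neg_ne_zero.mpr hv) (by rw [dotProduct_neg]; linarith)
  let w (t : ℝ) : ι → ℝ := (1 - t) • u + t • v
  have hu' : 0 < u ⬝ᵥ u := by
    have := dotProduct_star_self_pos_iff.mpr hu
    simpa using this
  have hv' : 0 < v ⬝ᵥ v := by
    have := dotProduct_star_self_pos_iff.mpr hv
    simpa using this
  have hw : ∀ t ∈ unitInterval, w t ⬝ᵥ w t ≠ 0 := by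
    rintro t ⟨h0, h1⟩
    have e : w t ⬝ᵥ w t =
        (1 - t) ^ 2 * (u ⬝ᵥ u) + 2 * (t * (1 - t)) * (u ⬝ᵥ v) + t ^ 2 * (v ⬝ᵥ v) := by
      simp only [w, add_dotProduct, dotProduct_add, smul_dotProduct, dotProduct_smul, smul_eq_mul,
        dotProduct_comm v u]
      ring
    have h2 : 0 ≤ 2 * (t * (1 - t)) * (u ⬝ᵥ v) :=
      mul_nonneg (mul_nonneg zero_le_two (mul_nonneg h0 (sub_nonneg.mpr h1))) huv
    rw [e]
    rcases h0.eq_or_lt with rfl | h0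
    · simpa using hu'.ne'
    · have := mul_pos (pow_pos h0 2) hv'
      have := mul_nonneg (sq_nonneg (1 - t)) hu'.le
      linarith
  refine JoinedIn.ofLine (f := fun t => householder u * householder (w t)) ?_ ?_ ?_ ?_
  · refine continuousOn_const.mul
      (continuousOn_const.sub (ContinuousOn.fun_smul (f := fun t => 2 / (w t ⬝ᵥ w t))
        (g := fun t => vecMulVec (w t) (w t)) ?_ ?_))
    · exact continuousOn_const.div (by fun_prop) hw
    · apply Continuous.continuousOn
      fun_prop
  · simp [w, householder_mul_self]
  · simp [w]
  · rintro _ ⟨t, -, rfl⟩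
    simp only [Set.mem_ofPred_eq, transpose_mul, transpose_householder]
    rw [Matrix.mul_assoc, ← Matrix.mul_assoc (householder u), householder_mul_self, Matrix.one_mul,
      householder_mul_self]

/-- Rotations can be joined to the identity by a path of orthogonal matrices. -/
theorem joinedIn_of_det_eq_one {A : Matrix ι ι ℝ} (hA : Aᵀ * A = 1) (hdet : A.det = 1) :
    JoinedIn {A | Aᵀ * A = 1} 1 A := by
  obtain ⟨l, rfl⟩ := exists_eq_prod_householder hA
  -- Pair adjacent reflections. An odd number leaves one unpaired, and the determinant is then `-1`.
  have key : ∀ l : List (ι → ℝ),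
      (JoinedIn {A | Aᵀ * A = 1} 1 (l.map householder).prod ∧ (l.map householder).prod.det = 1) ∨
      ∃ v ≠ 0, ∃ B : Matrix ι ι ℝ, JoinedIn {A | Aᵀ * A = 1} 1 B ∧ B.det = 1 ∧
        (l.map householder).prod = householder v * B := by
    intro l
    induction l with
    | nil => exact Or.inl ⟨JoinedIn.refl (by simp), by simp⟩
    | cons w l ih =>
      rw [List.map_cons, List.prod_cons]
      -- The list may contain zero vectors; they contribute the factor `1`.
      rcases eq_or_ne w 0 with rfl | hw
      · simpa using ih
      rcases ih with ⟨h1, h2⟩ | ⟨v, hv, B, h1, h2, h3⟩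
      · exact Or.inr ⟨w, hw, _, h1, h2, rfl⟩
      · rw [h3, ← Matrix.mul_assoc]
        refine Or.inl ⟨joinedIn_mul (joinedIn_householder_mul_householder hw hv) h1, ?_⟩
        rw [det_mul, det_mul, det_householder hw, det_householder hv, h2]
        norm_num
  rcases key l with ⟨h, -⟩ | ⟨v, hv, B, -, h2, h3⟩
  · exact h
  · rw [h3, det_mul, det_householder hv, h2] at hdet
    norm_num at hdet

end SpecialOrthogonal

/-! ### Pseudo-orthogonal matrices and the image of β -/

section PseudoOrthogonal

open Matrix
open scoped MatrixOrder

variable {m n : ℕ}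

/-- The Gram matrix `diag(I_m, -I_n)` of the inner product of signature `(m, n)`. -/
local notation "η" => LieAlgebra.Orthogonal.indefiniteDiagonal (Fin _) (Fin _) ℝ

theorem indefiniteDiagonal_eq_fromBlocks :
    LieAlgebra.Orthogonal.indefiniteDiagonal (Fin m) (Fin n) ℝ = fromBlocks 1 0 0 (-1) := by
  ext (i | i) (j | j) <;>
    simp [LieAlgebra.Orthogonal.indefiniteDiagonal, diagonal_apply, one_apply, apply_ite]

theorem indefiniteDiagonal_mul_self :
    LieAlgebra.Orthogonal.indefiniteDiagonal (Fin m) (Fin n) ℝ *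
      LieAlgebra.Orthogonal.indefiniteDiagonal (Fin m) (Fin n) ℝ = 1 := by
  simp [indefiniteDiagonal_eq_fromBlocks, fromBlocks_multiply]

/-- The matrix `M` preserves the inner product of signature `(m, n)`. -/
def IsPseudoOrthogonal (M : Matrix (Fin m ⊕ Fin n) (Fin m ⊕ Fin n) ℝ) : Prop :=
  Mᵀ * η * M = η

theorem IsPseudoOrthogonal.inv_mul {M : Matrix (Fin m ⊕ Fin n) (Fin m ⊕ Fin n) ℝ}
    (h : IsPseudoOrthogonal M) : (η * Mᵀ * η) * M = 1 := by
  rw [IsPseudoOrthogonal] at h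
  rw [Matrix.mul_assoc, Matrix.mul_assoc, ← Matrix.mul_assoc Mᵀ, h, indefiniteDiagonal_mul_self]

theorem IsPseudoOrthogonal.mul_inv {M : Matrix (Fin m ⊕ Fin n) (Fin m ⊕ Fin n) ℝ}
    (h : IsPseudoOrthogonal M) : M * (η * Mᵀ * η) = 1 :=
  mul_eq_one_comm.mp h.inv_mul

theorem IsPseudoOrthogonal.mul {M N : Matrix (Fin m ⊕ Fin n) (Fin m ⊕ Fin n) ℝ}
    (hM : IsPseudoOrthogonal M) (hN : IsPseudoOrthogonal N) : IsPseudoOrthogonal (M * N) := by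
  rw [IsPseudoOrthogonal] at hM hN ⊢
  calc _ = Nᵀ * (Mᵀ * η * M) * N := by simp only [transpose_mul, Matrix.mul_assoc]
    _ = _ := by rw [hM, hN]

/-- The block form of pseudo-orthogonality. -/
theorem isPseudoOrthogonal_fromBlocks_iff {A : Matrix (Fin m) (Fin m) ℝ}
    {B : Matrix (Fin m) (Fin n) ℝ} {C : Matrix (Fin n) (Fin m) ℝ} {D : Matrix (Fin n) (Fin n) ℝ} :
    IsPseudoOrthogonal (fromBlocks A B C D) ↔
      Aᵀ * A = 1 + Cᵀ * C ∧ Aᵀ * B = Cᵀ * D ∧ Dᵀ * D = 1 + Bᵀ * B := by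
  rw [IsPseudoOrthogonal, indefiniteDiagonal_eq_fromBlocks]
  simp only [fromBlocks_transpose, fromBlocks_multiply, fromBlocks_inj, Matrix.mul_one,
    Matrix.mul_zero, add_zero, zero_add, Matrix.mul_neg, Matrix.neg_mul]
  constructor
  · rintro ⟨h1, h2, -, h4⟩
    refine ⟨?_, ?_, ?_⟩
    · rw [← h1]; abel
    · rw [← sub_eq_zero, ← h2]; abel
    · have e : Dᵀ * D - (1 + Bᵀ * B) = -(Bᵀ * B + -(Dᵀ * D)) - 1 := by abel
      rw [← sub_eq_zero, e, h4, neg_neg, sub_self]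
  · rintro ⟨h1, h2, h4⟩
    have h3 := congrArg transpose h2
    simp only [transpose_mul, transpose_transpose] at h3
    rw [h1, h2, h3, h4]
    refine ⟨?_, ?_, ?_, ?_⟩ <;> abel

theorem IsPseudoOrthogonal.transpose {M : Matrix (Fin m ⊕ Fin n) (Fin m ⊕ Fin n) ℝ}
    (h : IsPseudoOrthogonal M) : IsPseudoOrthogonal Mᵀ := by
  have h1 := congrArg (· * η) h.mul_inv
  simpa [IsPseudoOrthogonal, Matrix.mul_assoc, indefiniteDiagonal_mul_self] using h1

theorem sqrtL_posSemidef (P : Matrix (Fin n) (Fin m) ℝ) : (sqrtL P).PosSemidef :=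
  (CFC.sqrt_nonneg (1 + Pᵀ * P)).posSemidef

theorem sqrtR_posSemidef (P : Matrix (Fin n) (Fin m) ℝ) : (sqrtR P).PosSemidef :=
  (CFC.sqrt_nonneg (1 + P * Pᵀ)).posSemidef

theorem posDef_one_add_transpose_mul_self {p q : Type*} [Fintype p] [Fintype q] [DecidableEq p]
    (P : Matrix q p ℝ) : (1 + Pᵀ * P).PosDef := by
  simpa using PosDef.one.add_posSemidef (posSemidef_conjTranspose_mul_self P)

theorem sqrtL_posDef (P : Matrix (Fin n) (Fin m) ℝ) : (sqrtL P).PosDef := by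
  rw [(sqrtL_posSemidef P).posDef_iff_isUnit]
  have h := (posDef_one_add_transpose_mul_self P).isUnit
  rw [← sqrtL_mul_self] at h
  exact isUnit_of_mul_isUnit_left h

theorem sqrtR_posDef (P : Matrix (Fin n) (Fin m) ℝ) : (sqrtR P).PosDef := by
  rw [(sqrtR_posSemidef P).posDef_iff_isUnit]
  have h := (posDef_one_add_transpose_mul_self Pᵀ).isUnit
  rw [transpose_transpose, ← sqrtR_mul_self] at h
  exact isUnit_of_mul_isUnit_left h

theorem transpose_sqrtL (P : Matrix (Fin n) (Fin m) ℝ) : (sqrtL P)ᵀ = sqrtL P := by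
  simpa using (sqrtL_posSemidef P).1.eq

theorem transpose_sqrtR (P : Matrix (Fin n) (Fin m) ℝ) : (sqrtR P)ᵀ = sqrtR P := by
  simpa using (sqrtR_posSemidef P).1.eq

theorem transpose_betaMatrix (P : Matrix (Fin n) (Fin m) ℝ) : (betaMatrix P)ᵀ = betaMatrix P := by
  simp [betaMatrix, fromBlocks_transpose, transpose_sqrtL, transpose_sqrtR]

theorem isPseudoOrthogonal_betaMatrix (P : Matrix (Fin n) (Fin m) ℝ) :
    IsPseudoOrthogonal (betaMatrix P) := by
  rw [betaMatrix, isPseudoOrthogonal_fromBlocks_iff, transpose_sqrtL, transpose_sqrtR]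
  simp [sqrtL_mul_self, sqrtR_mul_self, sqrtL_mul_transpose]

/-- Schur complement criterion: as `Pᵀ` intertwines the two square roots, the complement of the
positive definite block `sqrtL P` is `(sqrtR P)⁻¹`. -/
theorem posSemidef_betaMatrix (P : Matrix (Fin n) (Fin m) ℝ) : (betaMatrix P).PosSemidef := by
  have hL := sqrtL_posDef P
  have hR := sqrtR_posDef P
  have := hL.isUnit.invertible
  have dL := (isUnit_iff_isUnit_det _).mp hL.isUnit
  have dR := (isUnit_iff_isUnit_det _).mp hR.isUnit
  have key := PosDef.fromBlocks₁₁ Pᵀ (sqrtR P) hL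
  rw [conjTranspose_eq_transpose_of_trivial, transpose_transpose] at key
  rw [betaMatrix, key]
  have e : (sqrtL P)⁻¹ * Pᵀ = Pᵀ * (sqrtR P)⁻¹ := by
    calc _ = (sqrtL P)⁻¹ * (Pᵀ * sqrtR P) * (sqrtR P)⁻¹ := by
          rw [← Matrix.mul_assoc, mul_nonsing_inv_cancel_right _ _ dR]
      _ = _ := by rw [← sqrtL_mul_transpose, nonsing_inv_mul_cancel_left _ _ dL]
  have e2 : sqrtR P - P * (sqrtL P)⁻¹ * Pᵀ = (sqrtR P)⁻¹ := by
    calc _ = (sqrtR P * sqrtR P - P * Pᵀ) * (sqrtR P)⁻¹ := by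
          rw [Matrix.sub_mul, mul_nonsing_inv_cancel_right _ _ dR, Matrix.mul_assoc P, e,
            Matrix.mul_assoc P]
      _ = _ := by rw [sqrtR_mul_self, add_sub_cancel_right, Matrix.one_mul]
  rw [e2]
  exact (sqrtR_posSemidef P).inv

theorem sqrtL_eq {P : Matrix (Fin n) (Fin m) ℝ} {S : Matrix (Fin m) (Fin m) ℝ}
    (hS : S.PosSemidef) (h : S * S = 1 + Pᵀ * P) : sqrtL P = S :=
  CFC.sqrt_unique h hS.nonneg

theorem sqrtR_eq {P : Matrix (Fin n) (Fin m) ℝ} {S : Matrix (Fin n) (Fin n) ℝ}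
    (hS : S.PosSemidef) (h : S * S = 1 + P * Pᵀ) : sqrtR P = S :=
  CFC.sqrt_unique h hS.nonneg

/-- The matrices `β(P)` are the positive semidefinite pseudo-orthogonal matrices. -/
theorem betaMatrix_toBlocks₂₁ {M : Matrix (Fin m ⊕ Fin n) (Fin m ⊕ Fin n) ℝ}
    (hM : M.PosSemidef) (h : IsPseudoOrthogonal M) : betaMatrix M.toBlocks₂₁ = M := by
  have hA : M.toBlocks₁₁.PosSemidef := hM.submatrix Sum.inl
  have hD : M.toBlocks₂₂.PosSemidef := hM.submatrix Sum.inr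
  have hs : Mᵀ = M := by simpa using hM.1.eq
  rw [← fromBlocks_toBlocks M] at h hs
  rw [fromBlocks_transpose, fromBlocks_inj] at hs
  obtain ⟨h1, h2, h3, h4⟩ := hs
  obtain ⟨e1, -, e3⟩ := isPseudoOrthogonal_fromBlocks_iff.mp h
  -- By symmetry the block relations become `A² = 1 + CᵀC` and `D² = 1 + CCᵀ`, so uniqueness of
  -- positive semidefinite roots identifies `A` and `D`.
  rw [h1] at e1
  rw [h4, h3, ← h2] at e3
  conv_rhs => rw [← fromBlocks_toBlocks M]
  rw [betaMatrix, sqrtL_eq hA e1, sqrtR_eq hD e3, h2]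

theorem beta_eq_iff {P : Matrix (Fin n) (Fin m) ℝ} {g : GL (Fin m ⊕ Fin n) ℝ} :
    beta P = g ↔ betaMatrix P = g.val := Units.ext_iff

theorem mem_range_beta_iff {g : GL (Fin m ⊕ Fin n) ℝ} :
    g ∈ Set.range (beta : Matrix (Fin n) (Fin m) ℝ → _) ↔
      g.val.PosSemidef ∧ IsPseudoOrthogonal g.val := by
  constructor
  · rintro ⟨P, rfl⟩
    exact ⟨posSemidef_betaMatrix P, isPseudoOrthogonal_betaMatrix P⟩
  · rintro ⟨h1, h2⟩
    exact ⟨_, beta_eq_iff.mpr (betaMatrix_toBlocks₂₁ h1 h2)⟩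

theorem beta_injective : Function.Injective (beta : Matrix (Fin n) (Fin m) ℝ → _) := by
  intro P Q h
  have := congrArg (fun g => g.val.toBlocks₂₁) h
  simpa [beta, betaMatrix] using this

theorem beta_inv (P : Matrix (Fin n) (Fin m) ℝ) : (beta P)⁻¹ = beta (-P) :=
  inv_eq_of_mul_eq_one_right (Units.ext (betaMatrix_mul_neg P))

theorem isTwistedSubgroup_range_beta :
    IsTwistedSubgroup (Set.range (beta : Matrix (Fin n) (Fin m) ℝ → GL (Fin m ⊕ Fin n) ℝ)) where
  one_mem := mem_range_beta_iff.mpr ⟨PosSemidef.one, (pseudoOrthogonalGroup m n).one_mem⟩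
  inv_mem := by
    rintro _ ⟨P, rfl⟩
    exact ⟨-P, (beta_inv P).symm⟩
  mul_mul_mem := by
    rintro _ ⟨P, rfl⟩ b hb
    rw [mem_range_beta_iff] at hb ⊢
    refine ⟨?_, ((isPseudoOrthogonal_betaMatrix P).mul hb.2).mul (isPseudoOrthogonal_betaMatrix P)⟩
    have := hb.1.conjTranspose_mul_mul_same (betaMatrix P)
    rwa [conjTranspose_eq_transpose_of_trivial, transpose_betaMatrix] at this

theorem val_rho (O : specialOrthogonalGroup (Fin m) ℝ) :
    (rho m n O).val = fromBlocks O.val 0 0 1 := rfl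

theorem val_lam (O : specialOrthogonalGroup (Fin n) ℝ) :
    (lam m n O).val = fromBlocks 1 0 0 O.val := rfl

theorem val_beta (P : Matrix (Fin n) (Fin m) ℝ) : (beta P).val = betaMatrix P := rfl

theorem transpose_mul_self_of_mem {k : ℕ} (O : specialOrthogonalGroup (Fin k) ℝ) :
    O.valᵀ * O.val = 1 :=
  (mem_orthogonalGroup_iff' _ _).mp (mem_specialOrthogonalGroup_iff.mp O.2).1

theorem det_eq_one_of_mem {k : ℕ} (O : specialOrthogonalGroup (Fin k) ℝ) : O.val.det = 1 :=
  (mem_specialOrthogonalGroup_iff.mp O.2).2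

/-! ### Conjugation -/

theorem conj_mem_range_beta {g : GL (Fin m ⊕ Fin n) ℝ} (hg : g.valᵀ * g.val = 1)
    (hg' : IsPseudoOrthogonal g.val) {b : GL (Fin m ⊕ Fin n) ℝ}
    (hb : b ∈ Set.range (beta : Matrix (Fin n) (Fin m) ℝ → _)) :
    g * b * g⁻¹ ∈ Set.range (beta : Matrix (Fin n) (Fin m) ℝ → _) := by
  rw [mem_range_beta_iff] at hb ⊢
  have hinv : (g⁻¹).val = g.valᵀ := Units.inv_eq_of_mul_eq_one_left hg
  rw [Units.val_mul, Units.val_mul, hinv]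
  refine ⟨?_, (hg'.mul hb.2).mul hg'.transpose⟩
  simpa [Matrix.mul_assoc] using hb.1.conjTranspose_mul_mul_same g.valᵀ

theorem transpose_mul_self_rho (O : specialOrthogonalGroup (Fin m) ℝ) :
    (rho m n O).valᵀ * (rho m n O).val = 1 := by
  rw [val_rho]
  simp [fromBlocks_transpose, fromBlocks_multiply, transpose_mul_self_of_mem]

theorem transpose_mul_self_lam (O : specialOrthogonalGroup (Fin n) ℝ) :
    (lam m n O).valᵀ * (lam m n O).val = 1 := by
  rw [val_lam]
  simp [fromBlocks_transpose, fromBlocks_multiply, transpose_mul_self_of_mem]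

theorem isPseudoOrthogonal_rho (O : specialOrthogonalGroup (Fin m) ℝ) :
    IsPseudoOrthogonal (rho m n O).val := by
  rw [val_rho, isPseudoOrthogonal_fromBlocks_iff]
  simp [transpose_mul_self_of_mem]

theorem isPseudoOrthogonal_lam (O : specialOrthogonalGroup (Fin n) ℝ) :
    IsPseudoOrthogonal (lam m n O).val := by
  rw [val_lam, isPseudoOrthogonal_fromBlocks_iff]
  simp [transpose_mul_self_of_mem]

/-- The conjugate is known to lie in the image of `β`, so its lower left block determines it, and
that block is `P * O`. -/
theorem rho_inv_mul_beta_mul_rho (O : specialOrthogonalGroup (Fin m) ℝ)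
    (P : Matrix (Fin n) (Fin m) ℝ) :
    (rho m n O)⁻¹ * beta P * rho m n O = beta (P * O.val) := by
  have h := conj_mem_range_beta (b := beta P) (transpose_mul_self_rho (n := n) O⁻¹)
    (isPseudoOrthogonal_rho (n := n) O⁻¹) ⟨P, rfl⟩
  rw [map_inv, inv_inv] at h
  rw [mem_range_beta_iff] at h
  rw [eq_comm, beta_eq_iff, ← betaMatrix_toBlocks₂₁ h.1 h.2, ← map_inv]
  congr 1
  simp only [Units.val_mul, val_rho, val_beta, betaMatrix, fromBlocks_multiply,
    toBlocks_fromBlocks₂₁]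
  simp

/-- The reflection `diag(I_m, -I_n)` as an invertible matrix. -/
def indefiniteUnit (m n : ℕ) : GL (Fin m ⊕ Fin n) ℝ :=
  ⟨η, η, indefiniteDiagonal_mul_self, indefiniteDiagonal_mul_self⟩

/-- The Cartan involution `g ↦ η g η⁻¹`. -/
def cartanInvolution (m n : ℕ) : GL (Fin m ⊕ Fin n) ℝ →* GL (Fin m ⊕ Fin n) ℝ :=
  (MulAut.conj (indefiniteUnit m n)).toMonoidHom

theorem val_cartanInvolution (g : GL (Fin m ⊕ Fin n) ℝ) :
    (cartanInvolution m n g).val = η * g.val * η := rfl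

/-- Conjugation by `η` changes the sign of the off-diagonal blocks, hence replaces `P` by `-P`. -/
theorem cartanInvolution_beta (b) (hb : b ∈ Set.range (beta : Matrix (Fin n) (Fin m) ℝ → _)) :
    cartanInvolution m n b = b⁻¹ := by
  obtain ⟨P, rfl⟩ := hb
  rw [beta_inv]
  refine Units.ext ?_
  rw [val_cartanInvolution, indefiniteDiagonal_eq_fromBlocks, val_beta, val_beta]
  simp [betaMatrix, fromBlocks_multiply]

theorem cartanInvolution_rho (g) (hg : g ∈ (rho m n).range) : cartanInvolution m n g = g := by
  obtain ⟨O, rfl⟩ := hg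
  refine Units.ext ?_
  rw [val_cartanInvolution, indefiniteDiagonal_eq_fromBlocks, val_rho]
  simp [fromBlocks_multiply]

theorem cartanInvolution_lam (g) (hg : g ∈ (lam m n).range) : cartanInvolution m n g = g := by
  obtain ⟨O, rfl⟩ := hg
  refine Units.ext ?_
  rw [val_cartanInvolution, indefiniteDiagonal_eq_fromBlocks, val_lam]
  simp [fromBlocks_multiply]

theorem rho_mul_lam_comm (O : specialOrthogonalGroup (Fin m) ℝ)
    (O' : specialOrthogonalGroup (Fin n) ℝ) : rho m n O * lam m n O' = lam m n O' * rho m n O := by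
  refine Units.ext ?_
  rw [Units.val_mul, Units.val_mul, val_rho, val_lam]
  simp [fromBlocks_multiply]

/-! ### Paths of pseudo-orthogonal matrices -/

/-- A path of matrices lifts to the topology of the unit group because the inverse `η Mᵀ η` is
continuous in `M`. -/
theorem mem_specialPseudoOrthogonalGroup_of_joinedIn {g : GL (Fin m ⊕ Fin n) ℝ}
    (h : JoinedIn {M | IsPseudoOrthogonal M} 1 g.val) :
    g ∈ specialPseudoOrthogonalGroup m n := by
  let F (M : {M : Matrix (Fin m ⊕ Fin n) (Fin m ⊕ Fin n) ℝ | IsPseudoOrthogonal M}) :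
      pseudoOrthogonalGroup m n :=
    ⟨⟨M.1, η * M.1ᵀ * η, IsPseudoOrthogonal.mul_inv M.2, IsPseudoOrthogonal.inv_mul M.2⟩, M.2⟩
  have hF : Continuous F := by
    refine Continuous.subtype_mk (Units.continuous_iff.mpr ⟨continuous_subtype_val, ?_⟩) _
    change Continuous fun M : {M | IsPseudoOrthogonal M} => η * M.1ᵀ * η
    exact (continuous_const.matrix_mul continuous_subtype_val.matrix_transpose).matrix_mul
      continuous_const
  have h1 := (joinedIn_iff_joined h.source_mem h.target_mem).mp h
  have h2 := h1.map hF
  refine ⟨F ⟨g.val, h.target_mem⟩, ?_, Units.ext rfl⟩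
  have e : F ⟨1, h.source_mem⟩ = 1 := Subtype.ext (Units.ext rfl)
  rw [e] at h2
  exact h2

theorem rho_mem (O : specialOrthogonalGroup (Fin m) ℝ) :
    rho m n O ∈ specialPseudoOrthogonalGroup m n := by
  have h := (joinedIn_of_det_eq_one (transpose_mul_self_of_mem O) (det_eq_one_of_mem O)).map
    (f := fun A => (fromBlocks A 0 0 1 : Matrix (Fin m ⊕ Fin n) (Fin m ⊕ Fin n) ℝ))
    (by fun_prop)
  refine mem_specialPseudoOrthogonalGroup_of_joinedIn ?_
  rw [fromBlocks_one] at h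
  refine h.mono ?_
  rintro _ ⟨A, hA, rfl⟩
  rw [Set.mem_ofPred_eq, isPseudoOrthogonal_fromBlocks_iff]
  simpa using hA

theorem lam_mem (O : specialOrthogonalGroup (Fin n) ℝ) :
    lam m n O ∈ specialPseudoOrthogonalGroup m n := by
  have h := (joinedIn_of_det_eq_one (transpose_mul_self_of_mem O) (det_eq_one_of_mem O)).map
    (f := fun A => (fromBlocks 1 0 0 A : Matrix (Fin m ⊕ Fin n) (Fin m ⊕ Fin n) ℝ))
    (by fun_prop)
  refine mem_specialPseudoOrthogonalGroup_of_joinedIn ?_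
  rw [fromBlocks_one] at h
  refine h.mono ?_
  rintro _ ⟨A, hA, rfl⟩
  rw [Set.mem_ofPred_eq, isPseudoOrthogonal_fromBlocks_iff]
  simpa using hA

/-- A positive semidefinite pseudo-orthogonal matrix `M` is joined to the identity by the Cayley
path `((1 + t) I + (1 - t) M)⁻¹ ((1 - t) I + (1 + t) M)`. -/
theorem joinedIn_of_posSemidef {M : Matrix (Fin m ⊕ Fin n) (Fin m ⊕ Fin n) ℝ}
    (hM : M.PosSemidef) (h : IsPseudoOrthogonal M) : JoinedIn {M | IsPseudoOrthogonal M} 1 M := by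
  let L (s : ℝ) : Matrix (Fin m ⊕ Fin n) (Fin m ⊕ Fin n) ℝ := (1 - s) • 1 + (1 + s) • M
  have hs : Mᵀ = M := by simpa using hM.1.eq
  have hLt (s) : (L s)ᵀ = L s := by simp [L, hs]
  have hL : ∀ t ∈ unitInterval, IsUnit (L (-t)).det := by
    rintro t ⟨h0, h1⟩
    have hp : (L (-t)).PosDef := by
      refine PosDef.add_posSemidef (PosDef.one.smul (by linarith)) (hM.smul ?_)
      linarith
    exact hp.det_pos.ne'.isUnit
  have hcomm (s t) : L s * L t = L t * L s := by
    simp only [L, add_mul, mul_add, smul_mul_smul_comm, Matrix.one_mul, Matrix.mul_one,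
      mul_comm (1 - s), mul_comm (1 + s)]
    abel
  -- Since `MηM = η`, the product is `2(1 + s²)η + (1 - s²)(ηM + Mη)`, which is even in `s`. This
  -- makes the Cayley path pseudo-orthogonal.
  have hη (s) : L s * η * L s = L (-s) * η * L (-s) := by
    rw [IsPseudoOrthogonal, hs] at h
    simp only [L, add_mul, mul_add, Matrix.smul_mul, Matrix.mul_smul, Matrix.one_mul,
      Matrix.mul_one, h, smul_smul]
    module
  have hinvt (t) : ((L (-t))⁻¹)ᵀ = (L (-t))⁻¹ := by rw [transpose_nonsing_inv, hLt]
  refine JoinedIn.ofLine (f := fun t => (L (-t))⁻¹ * L t) ?_ ?_ ?_ ?_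
  · have hLc : Continuous L := by fun_prop
    have hLc' : Continuous fun t => L (-t) := hLc.comp continuous_neg
    refine ContinuousOn.mul ?_ hLc.continuousOn
    simp only [inv_def, Ring.inverse_eq_inv']
    exact ContinuousOn.smul
      (hLc'.matrix_det.continuousOn.inv₀ fun t ht => (hL t ht).ne_zero)
      hLc'.matrix_adjugate.continuousOn
  · simp only [neg_zero]
    exact nonsing_inv_mul _ (by simpa using hL 0 (by simp))
  · have : L (-1) = (2 : ℝ) • 1 := by simp [L]; norm_num
    have h2 : L 1 = (2 : ℝ) • 1 * M := by simp [L]; norm_num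
    have hu := hL 1 (by simp)
    simp only [this] at hu ⊢
    rw [h2, nonsing_inv_mul_cancel_left _ _ hu]
  · rintro _ ⟨t, ht, rfl⟩
    have hu := hL t ht
    have hc : L t * (L (-t))⁻¹ = (L (-t))⁻¹ * L t := by
      calc _ = (L (-t))⁻¹ * (L (-t) * L t) * (L (-t))⁻¹ := by
            rw [nonsing_inv_mul_cancel_left _ _ hu]
        _ = _ := by rw [← hcomm, ← Matrix.mul_assoc, mul_nonsing_inv_cancel_right _ _ hu]
    rw [Set.mem_ofPred_eq, IsPseudoOrthogonal, transpose_mul, hinvt, hLt]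
    calc _ = ((L (-t))⁻¹ * L t) * η * (L t * (L (-t))⁻¹) := by rw [hc]
      _ = (L (-t))⁻¹ * (L t * η * L t) * (L (-t))⁻¹ := by simp only [Matrix.mul_assoc]
      _ = ((L (-t))⁻¹ * L (-t)) * η * (L (-t) * (L (-t))⁻¹) := by
        rw [hη]; simp only [Matrix.mul_assoc]
      _ = _ := by
        rw [nonsing_inv_mul _ hu, mul_nonsing_inv _ hu, Matrix.one_mul, Matrix.mul_one]

theorem beta_mem (P : Matrix (Fin n) (Fin m) ℝ) : beta P ∈ specialPseudoOrthogonalGroup m n :=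
  mem_specialPseudoOrthogonalGroup_of_joinedIn
    (joinedIn_of_posSemidef (posSemidef_betaMatrix P) (isPseudoOrthogonal_betaMatrix P))

theorem pos_of_continuous_of_ne_zero {f : unitInterval → ℝ} (hf : Continuous f)
    (h : ∀ t, f t ≠ 0) (h0 : 0 < f 0) : 0 < f 1 := by
  by_contra! h1
  obtain ⟨t, ht⟩ := mem_range_of_exists_le_of_exists_ge hf ⟨1, h1⟩ ⟨0, h0.le⟩
  exact h t ht

theorem IsPseudoOrthogonal.det_toBlocks_ne_zero {M : Matrix (Fin m ⊕ Fin n) (Fin m ⊕ Fin n) ℝ}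
    (h : IsPseudoOrthogonal M) : M.toBlocks₁₁.det ≠ 0 ∧ M.toBlocks₂₂.det ≠ 0 := by
  rw [← fromBlocks_toBlocks M] at h
  obtain ⟨h1, -, h2⟩ := isPseudoOrthogonal_fromBlocks_iff.mp h
  have e1 := (posDef_one_add_transpose_mul_self M.toBlocks₂₁).det_pos
  have e2 := (posDef_one_add_transpose_mul_self M.toBlocks₁₂).det_pos
  rw [← h1, det_mul, det_transpose] at e1
  rw [← h2, det_mul, det_transpose] at e2
  exact ⟨fun h => by simp [h] at e1, fun h => by simp [h] at e2⟩

theorem isPseudoOrthogonal_of_mem {g : GL (Fin m ⊕ Fin n) ℝ}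
    (hg : g ∈ specialPseudoOrthogonalGroup m n) : IsPseudoOrthogonal g.val := by
  obtain ⟨g, -, rfl⟩ := hg
  exact g.2

/-- Along a path from the identity both determinants are continuous, never zero, and start at `1`.
-/
theorem det_toBlocks_pos {g : GL (Fin m ⊕ Fin n) ℝ}
    (hg : g ∈ specialPseudoOrthogonalGroup m n) :
    0 < g.val.toBlocks₁₁.det ∧ 0 < g.val.toBlocks₂₂.det := by
  obtain ⟨g, ⟨γ⟩, rfl⟩ := hg
  have hc : Continuous fun t => (γ t).1.val :=
    Units.continuous_val.comp (continuous_subtype_val.comp γ.continuous)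
  have hγ (t) : IsPseudoOrthogonal (γ t).1.val := (γ t).2
  have h1 := pos_of_continuous_of_ne_zero (f := fun t => (γ t).1.val.toBlocks₁₁.det)
    ((hc.matrix_submatrix Sum.inl Sum.inl).matrix_det) (fun t => (hγ t).det_toBlocks_ne_zero.1)
    (by rw [γ.source, OneMemClass.coe_one, Units.val_one, ← fromBlocks_one,
      toBlocks_fromBlocks₁₁, det_one]; exact one_pos)
  have h2 := pos_of_continuous_of_ne_zero (f := fun t => (γ t).1.val.toBlocks₂₂.det)
    ((hc.matrix_submatrix Sum.inr Sum.inr).matrix_det) (fun t => (hγ t).det_toBlocks_ne_zero.2)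
    (by rw [γ.source, OneMemClass.coe_one, Units.val_one, ← fromBlocks_one,
      toBlocks_fromBlocks₂₂, det_one]; exact one_pos)
  rw [γ.target] at h1 h2
  exact ⟨h1, h2⟩

/-! ### The bi-decomposition of `SO(m, n)` -/

theorem det_eq_one_of_transpose_mul_self {k : ℕ} {A : Matrix (Fin k) (Fin k) ℝ} (h : Aᵀ * A = 1)
    (hA : 0 < A.det) : A.det = 1 := by
  have := congrArg det h
  rw [det_mul, det_transpose, det_one] at this
  nlinarith

/-- Outer factors `diag(O, 1)` and `diag(1, O')` leave the lower left block of `β(P)` unchanged, so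
`P` must be that block `C`. The diagonal blocks then force `O` and `O'`, which are orthogonal by
`AᵀA = 1 + CᵀC` and `DDᵀ = 1 + CCᵀ`. The formula for `O` is recorded because it becomes `rgyrU` for
a product of two `β`'s. -/
theorem exists_decomposition {g : GL (Fin m ⊕ Fin n) ℝ}
    (hg : g ∈ specialPseudoOrthogonalGroup m n) :
    ∃ (O : specialOrthogonalGroup (Fin m) ℝ) (O' : specialOrthogonalGroup (Fin n) ℝ),
      O.val = g.val.toBlocks₁₁ * (sqrtL g.val.toBlocks₂₁)⁻¹ ∧
      g = rho m n O * beta g.val.toBlocks₂₁ * lam m n O' := by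
  obtain ⟨hdetA, hdetD⟩ := det_toBlocks_pos hg
  have hpo := isPseudoOrthogonal_of_mem hg
  have hpot := hpo.transpose
  have hblocks := fromBlocks_toBlocks g.val
  rw [← hblocks] at hpo hpot
  rw [fromBlocks_transpose] at hpot
  obtain ⟨h1, h2, -⟩ := isPseudoOrthogonal_fromBlocks_iff.mp hpo
  obtain ⟨-, -, h3⟩ := isPseudoOrthogonal_fromBlocks_iff.mp hpot
  rw [transpose_transpose, transpose_transpose] at h3
  set A := g.val.toBlocks₁₁
  set B := g.val.toBlocks₁₂
  set C := g.val.toBlocks₂₁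
  set D := g.val.toBlocks₂₂
  have hL := (sqrtL_posDef C).det_pos
  have hR := (sqrtR_posDef C).det_pos
  have uL := hL.ne'.isUnit
  have uR := hR.ne'.isUnit
  have tL : ((sqrtL C)⁻¹)ᵀ = (sqrtL C)⁻¹ := by rw [transpose_nonsing_inv, transpose_sqrtL]
  have tR : ((sqrtR C)⁻¹)ᵀ = (sqrtR C)⁻¹ := by rw [transpose_nonsing_inv, transpose_sqrtR]
  have hO : (A * (sqrtL C)⁻¹)ᵀ * (A * (sqrtL C)⁻¹) = 1 := by
    rw [transpose_mul, tL, Matrix.mul_assoc, ← Matrix.mul_assoc Aᵀ, h1, ← sqrtL_mul_self,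
      mul_nonsing_inv_cancel_right _ _ uL, nonsing_inv_mul _ uL]
  have hO' : ((sqrtR C)⁻¹ * D)ᵀ * ((sqrtR C)⁻¹ * D) = 1 := by
    rw [mul_eq_one_comm, transpose_mul, tR, Matrix.mul_assoc, ← Matrix.mul_assoc D, h3,
      ← sqrtR_mul_self, mul_nonsing_inv_cancel_right _ _ uR, nonsing_inv_mul _ uR]
  have dO : (A * (sqrtL C)⁻¹).det = 1 :=
    det_eq_one_of_transpose_mul_self hO (by
      rw [det_mul, det_nonsing_inv, Ring.inverse_eq_inv']
      exact mul_pos hdetA (inv_pos.mpr hL))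
  have dO' : ((sqrtR C)⁻¹ * D).det = 1 :=
    det_eq_one_of_transpose_mul_self hO' (by
      rw [det_mul, det_nonsing_inv, Ring.inverse_eq_inv']
      exact mul_pos (inv_pos.mpr hR) hdetD)
  refine ⟨⟨_, mem_specialOrthogonalGroup_iff.mpr ⟨(mem_orthogonalGroup_iff' _ _).mpr hO, dO⟩⟩,
    ⟨_, mem_specialOrthogonalGroup_iff.mpr ⟨(mem_orthogonalGroup_iff' _ _).mpr hO', dO'⟩⟩, rfl, ?_⟩
  refine Units.ext ?_
  rw [Units.val_mul, Units.val_mul, val_rho, val_lam, val_beta, ← hblocks, betaMatrix]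
  simp only [fromBlocks_multiply, Matrix.one_mul, Matrix.mul_one, Matrix.zero_mul, Matrix.mul_zero,
    add_zero, zero_add, fromBlocks_inj]
  refine ⟨(nonsing_inv_mul_cancel_right _ _ uL).symm, ?_, trivial,
    (mul_nonsing_inv_cancel_left _ _ uR).symm⟩
  -- The upper right block is checked after multiplication by the invertible `Aᵀ`, where the
  -- relation `AᵀB = CᵀD` applies.
  have hAt : IsUnit Aᵀ.det := by rw [det_transpose]; exact hdetA.ne'.isUnit
  apply_fun (Aᵀ * ·) using fun X Y h => by
    simpa only [nonsing_inv_mul_cancel_left _ _ hAt] using congrArg (Aᵀ⁻¹ * ·) h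
  calc Aᵀ * B = Cᵀ * (sqrtR C * ((sqrtR C)⁻¹ * D)) := by
        rw [mul_nonsing_inv_cancel_left _ _ uR, h2]
    _ = sqrtL C * Cᵀ * ((sqrtR C)⁻¹ * D) := by rw [sqrtL_mul_transpose, Matrix.mul_assoc]
    _ = Aᵀ * A * (sqrtL C)⁻¹ * Cᵀ * ((sqrtR C)⁻¹ * D) := by
        rw [h1, ← sqrtL_mul_self, mul_nonsing_inv_cancel_right _ _ uL]
    _ = _ := by simp only [Matrix.mul_assoc]

theorem decomposition_injective {O Q : specialOrthogonalGroup (Fin m) ℝ}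
    {O' Q' : specialOrthogonalGroup (Fin n) ℝ} {P R : Matrix (Fin n) (Fin m) ℝ}
    (h : rho m n O * beta P * lam m n O' = rho m n Q * beta R * lam m n Q') :
    O = Q ∧ P = R ∧ O' = Q' := by
  have h' := congrArg Units.val h
  simp only [Units.val_mul, val_rho, val_beta, val_lam, betaMatrix, fromBlocks_multiply,
    Matrix.one_mul, Matrix.mul_one, Matrix.zero_mul, Matrix.mul_zero, add_zero, zero_add,
    fromBlocks_inj] at h'
  obtain ⟨h1, -, rfl, h2⟩ := h'
  exact ⟨Subtype.ext ((sqrtL_posDef P).isUnit.mul_left_injective h1), rfl,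
    Subtype.ext ((sqrtR_posDef P).isUnit.mul_right_injective h2)⟩

theorem isBiTransversal_specialPseudoOrthogonalGroup (m n : ℕ) :
    IsBiTransversal (specialPseudoOrthogonalGroup m n) (rho m n).range
      (Set.range (beta : Matrix (Fin n) (Fin m) ℝ → GL (Fin m ⊕ Fin n) ℝ)) (lam m n).range where
  left_le := by rintro _ ⟨O, rfl⟩; exact rho_mem O
  subset := by rintro _ ⟨P, rfl⟩; exact beta_mem P
  right_le := by rintro _ ⟨O, rfl⟩; exact lam_mem O
  existsUnique g hg := by
    obtain ⟨O, O', -, h⟩ := exists_decomposition hg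
    refine ⟨(⟨_, O, rfl⟩, ⟨_, _, rfl⟩, ⟨_, O', rfl⟩), h, ?_⟩
    rintro ⟨⟨_, Q, rfl⟩, ⟨_, R, rfl⟩, ⟨_, Q', rfl⟩⟩ h'
    obtain ⟨rfl, rfl, rfl⟩ := decomposition_injective (h'.symm.trans h)
    rfl

theorem isBiGyrotransversal_specialPseudoOrthogonalGroup (m n : ℕ) :
    IsBiGyrotransversal (specialPseudoOrthogonalGroup m n) (rho m n).range
      (Set.range (beta : Matrix (Fin n) (Fin m) ℝ → GL (Fin m ⊕ Fin n) ℝ)) (lam m n).range where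
  toIsBiTransversal := isBiTransversal_specialPseudoOrthogonalGroup m n
  left_normalizes := by
    rintro _ ⟨O, rfl⟩ b hb
    exact conj_mem_range_beta (transpose_mul_self_rho O) (isPseudoOrthogonal_rho O) hb
  right_normalizes := by
    rintro _ ⟨O, rfl⟩ b hb
    exact conj_mem_range_beta (transpose_mul_self_lam O) (isPseudoOrthogonal_lam O) hb
  comm := by rintro _ ⟨O, rfl⟩ _ ⟨O', rfl⟩; exact rho_mul_lam_comm O O'

theorem isBiGyrodecomposition_specialPseudoOrthogonalGroup (m n : ℕ) :
    IsBiGyrodecomposition (specialPseudoOrthogonalGroup m n) (rho m n).range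
      (Set.range (beta : Matrix (Fin n) (Fin m) ℝ → GL (Fin m ⊕ Fin n) ℝ)) (lam m n).range :=
  (isBiGyrotransversal_specialPseudoOrthogonalGroup m n).isBiGyrodecomposition
    isTwistedSubgroup_range_beta (cartanInvolution m n) cartanInvolution_beta cartanInvolution_rho
    cartanInvolution_lam

/-! ### The bi-gyrogroup operation in coordinates -/

theorem exists_decomposition_beta_mul_beta (P₁ P₂ : Matrix (Fin n) (Fin m) ℝ) :
    ∃ (O : specialOrthogonalGroup (Fin m) ℝ) (O' : specialOrthogonalGroup (Fin n) ℝ),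
      O.val = rgyrU P₁ P₂ ∧
      beta P₁ * beta P₂ = rho m n O * beta (addU P₁ P₂) * lam m n O' := by
  have hval : (beta P₁ * beta P₂).val = betaMatrix P₁ * betaMatrix P₂ := rfl
  have h := exists_decomposition
    ((specialPseudoOrthogonalGroup m n).mul_mem (beta_mem P₁) (beta_mem P₂))
  rwa [hval, betaMatrix, betaMatrix, fromBlocks_multiply, toBlocks_fromBlocks₁₁,
    toBlocks_fromBlocks₂₁, add_comm (sqrtL P₁ * sqrtL P₂)] at h

/-- The left factor of `β(P₂)β(P₁)` is `ρ(rgyr[P₂, P₁])`, and conjugating `β(P₁ ⊕_U P₂)` by its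
inverse multiplies the parameter on the right by `rgyr[P₂, P₁]`. -/
theorem op_beta (h : IsBiGyrodecomposition (specialPseudoOrthogonalGroup m n) (rho m n).range
      (Set.range (beta : Matrix (Fin n) (Fin m) ℝ → GL (Fin m ⊕ Fin n) ℝ)) (lam m n).range)
    (P₁ P₂ : Matrix (Fin n) (Fin m) ℝ) :
    h.op ⟨beta P₁, Set.mem_range_self P₁⟩ ⟨beta P₂, Set.mem_range_self P₂⟩ =
      ⟨beta (addU P₁ P₂ * rgyrU P₂ P₁), Set.mem_range_self _⟩ := by
  obtain ⟨O, O', -, e⟩ := exists_decomposition_beta_mul_beta P₁ P₂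
  obtain ⟨Q, Q', hQ, f⟩ := exists_decomposition_beta_mul_beta P₂ P₁
  have h1 := (h.maps_eq (a := ⟨_, P₁, rfl⟩) (b := ⟨_, P₂, rfl⟩) (c := ⟨_, _, rfl⟩)
    (x := ⟨_, O, rfl⟩) (u := ⟨_, O', rfl⟩) e).2.1
  have h2 := (h.maps_eq (a := ⟨_, P₂, rfl⟩) (b := ⟨_, P₁, rfl⟩) (c := ⟨_, _, rfl⟩)
    (x := ⟨_, Q, rfl⟩) (u := ⟨_, Q', rfl⟩) f).1
  refine Subtype.ext ?_
  change (h.leftMap ⟨beta P₂, _⟩ ⟨beta P₁, _⟩ : GL (Fin m ⊕ Fin n) ℝ)⁻¹ *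
    h.biOp ⟨beta P₁, _⟩ ⟨beta P₂, _⟩ * h.leftMap ⟨beta P₂, _⟩ ⟨beta P₁, _⟩ = _
  rw [h1, h2, ← hQ]
  exact rho_inv_mul_beta_mul_rho Q _

end PseudoOrthogonal

end BiGyro

/-- `SO(m, n) = ρ(SO(m)) β(ℝ^{n×m}) λ(SO(n))` is a bi-gyrodecomposition. The bi-gyrogroup operation
`⊕` that it induces on the set `β(ℝ^{n×m})` is given by
`β(P₁) ⊕ β(P₂) = β((P₁ ⊕_U P₂) rgyr[P₂, P₁])`, it makes `β(ℝ^{n×m})` a gyrocommutative gyrogroup,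
and `β` is an isomorphism from the gyrocommutative gyrogroup `(ℝ^{n×m}, ⊕'_U)` onto it. -/
theorem mainTheorem7 (m n : ℕ) :
    ∃ h : IsBiGyrodecomposition (specialPseudoOrthogonalGroup m n) (rho m n).range
        (Set.range (beta : Matrix (Fin n) (Fin m) ℝ → GL (Fin m ⊕ Fin n) ℝ)) (lam m n).range,
      (∀ P₁ P₂ : Matrix (Fin n) (Fin m) ℝ,
        h.op ⟨beta P₁, Set.mem_range_self P₁⟩ ⟨beta P₂, Set.mem_range_self P₂⟩ =
          ⟨beta (addU P₁ P₂ * rgyrU P₂ P₁), Set.mem_range_self _⟩) ∧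
      IsGyrocommutativeGyrogroup h.op ∧
      IsGyrocommutativeGyrogroup (addU' : Matrix (Fin n) (Fin m) ℝ → _ → _) ∧
      IsGroupoidIso (addU' : Matrix (Fin n) (Fin m) ℝ → _ → _) h.op
        (fun P => ⟨beta P, Set.mem_range_self P⟩) := by
  have h := isBiGyrodecomposition_specialPseudoOrthogonalGroup m n
  have hop := h.isGyrocommutativeGyrogroup_op (cartanInvolution m n) cartanInvolution_beta
    cartanInvolution_rho cartanInvolution_lam
  have hiso : IsGroupoidIso (addU' : Matrix (Fin n) (Fin m) ℝ → _ → _) h.op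
      (fun P => ⟨beta P, Set.mem_range_self P⟩) :=
    ⟨⟨fun P Q e => beta_injective (congrArg Subtype.val e), by
      rintro ⟨_, P, rfl⟩; exact ⟨P, rfl⟩⟩, fun P Q => (op_beta h P Q).symm⟩
  exact ⟨h, op_beta h, hop, hiso.isGyrocommutativeGyrogroup hop, hiso⟩
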